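/- Let $W$ and $M$ be disjoint sets (of women and men) with $|W|=|M|=n$. Each woman has a full preference list, i.e. a total ordering of $M$, and each man has a total ordering of $W$. A perfect marriage is a bijection $\mu:W\to M$; it is stable if there is no pair $(w',m')\in W\times M$ such that $w'$ prefers $m'$ over her spouse in $\mu$ and $m'$ prefers $w'$ over his spouse in $\mu$. Alice holds the preference lists of all women and Bob holds the preference lists of all men. Fix a pair $(w,m)\in W\times M$, known to both. The randomized communication complexity of a decision problem is the least $k$ such that some randomized two-party protocol (in Yao's model, with shared and private randomness allowed) exchanges at most $k$ bits on every input and every outcome of its coins, and on every fixed input outputs the correct answer with probability at least $\frac23$. Then the randomized communication complexity of determining whether $w$ and $m$ are married to each other in some stable marriage is $\Omega(n^2)$, and so is that of determining whether $w$ and $m$ are married to each other in every stable marriage. That is, for each of the two problems there are constants $c>0$ and $N$ such that for all $n\ge N$, all such $W$ and $M$, and all $(w,m)\in W\times M$, its randomized communication complexity is at least $c\,n^2$. -/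

import Mathlib

open MeasureTheory
open scoped ENNReal

/-! ### Marriage markets with full preference lists -/

/-- A full preference list over `α`: a strict total order, where `L.1 a b` says that `a` precedes
(is strictly preferred over) `b`. -/
def PrefList (α : Type*) : Type _ := {r : α → α → Prop // IsStrictTotalOrder α r}

/-- A profile of full preference lists for `A` over `B`. -/
def Profile (A B : Type*) : Type _ := A → PrefList B

instance {A B : Type*} [Finite A] [Finite B] : Finite (Profile A B) := by
  have : Finite (PrefList B) :=
    inferInstanceAs (Finite {r : B → B → Prop // IsStrictTotalOrder B r})
  exact inferInstanceAs (Finite (A → PrefList B))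

/-- In the profile `P`, participant `a` prefers `b` over `b'`. -/
def Profile.Prefers {A B : Type*} (P : Profile A B) (a : A) (b b' : B) : Prop := (P a).1 b b'

/-- `(w, m)` is a blocking pair with respect to the perfect marriage `μ`: each of them prefers the
other over their spouse in `μ`. -/
def IsBlockingPair {W M : Type*} (PW : Profile W M) (PM : Profile M W) (μ : W ≃ M)
    (w : W) (m : M) : Prop :=
  PW.Prefers w m (μ w) ∧ PM.Prefers m w (μ.symm m)

/-- A perfect marriage is stable if it has no blocking pair. -/
def IsStable {W M : Type*} (PW : Profile W M) (PM : Profile M W) (μ : W ≃ M) : Prop :=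
  ∀ w m, ¬ IsBlockingPair PW PM μ w m

/-- The pair `(w, m)` is married in some stable marriage. -/
def InSomeStable {W M : Type*} (w : W) (m : M) (PW : Profile W M) (PM : Profile M W) : Prop :=
  ∃ μ : W ≃ M, IsStable PW PM μ ∧ μ w = m

/-- The pair `(w, m)` is married in every stable marriage. -/
def InEveryStable {W M : Type*} (w : W) (m : M) (PW : Profile W M) (PM : Profile M W) : Prop :=
  ∀ μ : W ≃ M, IsStable PW PM μ → μ w = m

/-! ### Two-party communication complexity -/

/-- A deterministic two-party protocol (a protocol tree) in which Alice holds an element of `X` and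
Bob holds an element of `Y`. At each step one of them, determined by the bits exchanged so far,
sends a bit that depends on their own input (and on the bits exchanged so far); at the end, the
bits exchanged determine the output. -/
inductive Protocol (X Y Z : Type*) where
  | output (z : Z) : Protocol X Y Z
  | alice (send : X → Bool) (next : Bool → Protocol X Y Z) : Protocol X Y Z
  | bob (send : Y → Bool) (next : Bool → Protocol X Y Z) : Protocol X Y Z

namespace Protocol

variable {X Y Z : Type*}

/-- The output of a protocol on the input `(x, y)`. -/
def run : Protocol X Y Z → X → Y → Z
  | output z, _, _ => z
  | alice send next, x, y => (next (send x)).run x y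
  | bob send next, x, y => (next (send y)).run x y

/-- The number of bits exchanged by a protocol on the input `(x, y)`. -/
def bits : Protocol X Y Z → X → Y → ℕ
  | output _, _, _ => 0
  | alice send next, x, y => (next (send x)).bits x y + 1
  | bob send next, x, y => (next (send y)).bits x y + 1

end Protocol

/-- `f` is decided, with probability at least `2/3` of a correct answer on every fixed input, by a
randomized protocol that never exchanges more than `k` bits. The outcome `ω` of the random coins
is drawn from an arbitrary probability space, independently of the input, and everything that the
players do may depend on it. Private coins are the special case where `ω` is a pair of independent
outcomes and each player uses only the corresponding component. -/
def RandDecidableWith {X Y : Type*} (f : X → Y → Prop) (k : ℕ) : Prop :=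
  ∃ (Ω : Type) (_ : MeasurableSpace Ω) (P : Measure Ω) (_ : IsProbabilityMeasure P)
    (p : Protocol (X × Ω) (Y × Ω) Bool),
    (∀ x y ω, p.bits (x, ω) (y, ω) ≤ k) ∧
    ∀ x y, MeasurableSet {ω | p.run (x, ω) (y, ω) = true ↔ f x y} ∧
      (2 / 3 : ℝ≥0∞) ≤ P {ω | p.run (x, ω) (y, ω) = true ↔ f x y}

/-- The randomized communication complexity of the decision problem `f`: the lowest worst-case
number of bits exchanged by a randomized protocol for `f`. For finitely many inputs this is a
minimum over a nonempty set, by `exists_randDecidableWith` below. -/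
noncomputable def randCC {X Y : Type*} (f : X → Y → Prop) : ℕ :=
  sInf {k | RandDecidableWith f k}

/-- A protocol in which Alice first announces (if it is in the list `l`) what her input is. -/
theorem Protocol.exists_alice {X Y Z : Type*} (T : X → Protocol X Y Z) (D : Protocol X Y Z)
    (l : List X) : ∃ p : Protocol X Y Z, ∀ x ∈ l, ∀ y,
      p.run x y = (T x).run x y ∧ p.bits x y ≤ (T x).bits x y + l.length := by
  classical
  induction l with
  | nil => exact ⟨D, by simp⟩
  | cons a l ih =>
    obtain ⟨p, hp⟩ := ih
    refine ⟨.alice (fun x => decide (x = a)) (fun b => bif b then T a else p), ?_⟩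
    intro x hx y
    by_cases h : x = a
    · subst h
      simp only [run, bits, decide_true, cond_true, List.length_cons]
      exact ⟨trivial, by omega⟩
    · have := hp x (by simpa [h] using hx) y
      simp only [run, bits, h, decide_false, cond_false, List.length_cons]
      exact ⟨this.1, by omega⟩

/-- A protocol in which Bob first announces (if it is in the list `l`) what his input is. -/
theorem Protocol.exists_bob {X Y Z : Type*} (T : Y → Z) (D : Protocol X Y Z)
    (l : List Y) : ∃ p : Protocol X Y Z, ∀ y ∈ l, ∀ x,
      p.run x y = T y ∧ p.bits x y ≤ l.length := by
  classical
  induction l with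
  | nil => exact ⟨D, by simp⟩
  | cons a l ih =>
    obtain ⟨p, hp⟩ := ih
    refine ⟨.bob (fun y => decide (y = a)) (fun b => bif b then .output (T a) else p), ?_⟩
    intro y hy x
    by_cases h : y = a
    · subst h
      simp [run, bits]
    · have := hp y (by simpa [h] using hy) x
      simp only [run, bits, h, decide_false, cond_false, List.length_cons]
      exact ⟨this.1, by omega⟩

/-- Every decision problem with finitely many inputs is decided by some protocol. -/
theorem exists_randDecidableWith {X Y : Type*} [Finite X] [Finite Y] (f : X → Y → Prop) :
    ∃ k, RandDecidableWith f k := by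
  classical
  obtain ⟨lX, hX⟩ := (Set.toFinite (Set.univ : Set (X × Unit))).toFinset.exists_list_nodup_eq.imp
    fun l h => show ∀ x, x ∈ l by
      intro x
      have := congrArg (x ∈ ·) h.2
      simpa using this
  obtain ⟨lY, hY⟩ := (Set.toFinite (Set.univ : Set (Y × Unit))).toFinset.exists_list_nodup_eq.imp
    fun l h => show ∀ x, x ∈ l by
      intro x
      have := congrArg (x ∈ ·) h.2
      simpa using this
  have hb : ∀ x : X × Unit, ∃ p : Protocol (X × Unit) (Y × Unit) Bool, ∀ y x',
      p.run x' y = decide (f x.1 y.1) ∧ p.bits x' y ≤ lY.length := by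
    intro x
    obtain ⟨p, hp⟩ := Protocol.exists_bob (X := X × Unit)
      (fun y : Y × Unit => decide (f x.1 y.1)) (.output true) lY
    exact ⟨p, fun y x' => hp y (hY y) x'⟩
  choose T hT using hb
  obtain ⟨p, hp⟩ := Protocol.exists_alice T (.output true) lX
  refine ⟨lY.length + lX.length, Unit, inferInstance, Measure.dirac (), inferInstance, p, ?_, ?_⟩
  · intro x y ω
    have h1 := (hp (x, ω) (hX _) (y, ω)).2
    have h2 := (hT (x, ω) (y, ω) (x, ω)).2
    omega
  · intro x y
    have h : {ω | p.run (x, ω) (y, ω) = true ↔ f x y} = Set.univ := by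
      ext ω
      have h1 := (hp (x, ω) (hX _) (y, ω)).1
      have h2 := (hT (x, ω) (y, ω) (x, ω)).1
      simp [h1, h2]
    rw [h]
    refine ⟨MeasurableSet.univ, ?_⟩
    rw [measure_univ]
    exact ENNReal.div_le_of_le_mul (by norm_num)

/-! Both problems contain unique disjointness on about n²/4 points, which costs every randomized
protocol a linear number of bits.

The points are the pairs (i, j) in ι × κ, where |ι| + |κ| + 1 = n. Alice's set x says which men j
tempt woman i away from man i; Bob's set y says which women i tempt man j away from woman j. If x
and y are disjoint, no temptation is mutual, and marrying all namesakes, w and m among them, is the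
only stable marriage (`eq_none_of_scoreWeaklyStable`). If (i, j) is a common point, no stable
marriage contains (w, m) (`ne_none_of_scoreWeaklyStable`). If it is the only one, an explicit stable
marriage exists (`scoreStable_cycle`), so "some" and "every" have the same answer on all these
inputs.

Unique disjointness is handled by corruption. A disjoint pair is drawn by splitting a random z along
a random S. Either a rectangle keeps a fair share of its mass when i is added to both sets, or it is
biased at i (`corruption_coordinate`). The level-one inequality `sum_sq_coeff_div_le` bounds the
total bias, so a rectangle that is not too sparse on disjoint pairs also holds many uniquely
intersecting ones. Summing over the leaves of a protocol (`corruption_protocol`) and averaging over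
the coins gives the bound. -/

/-! ### Averages over the discrete cube -/

namespace Cube

open Finset
open scoped BigOperators

/-- The `i`-th coordinate of the point `z` of the cube, as a sign. -/
def sign {ι : Type*} [DecidableEq ι] (i : ι) (z : Finset ι) : ℝ := if i ∈ z then 1 else -1

/-- The density of a combinatorial rectangle `f × g` with respect to the distribution of disjoint
pairs `(z ∩ S, z \ S)`, for a fixed splitting `S` of the coordinates. -/
noncomputable def splitAvg {ι : Type*} [Fintype ι] [DecidableEq ι] (f g : Finset ι → ℝ)
    (S : Finset ι) : ℝ := 𝔼 z : Finset ι, f (z ∩ S) * g (z \ S)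

/-- The first-level Fourier coefficients of `z ↦ f (z ∩ S) * g (z \ S)`. -/
noncomputable def splitCoeff {ι : Type*} [Fintype ι] [DecidableEq ι] (f g : Finset ι → ℝ)
    (S : Finset ι) (i : ι) : ℝ := 𝔼 z : Finset ι, f (z ∩ S) * g (z \ S) * sign i z

/-- The density of the rectangle `f × g` with respect to the distribution of pairs of sets that
intersect exactly in `i`, for a fixed splitting `S` of the coordinates. -/
noncomputable def meetAvg {ι : Type*} [Fintype ι] [DecidableEq ι] (f g : Finset ι → ℝ)
    (S : Finset ι) (i : ι) : ℝ :=
  𝔼 z : Finset ι, f (insert i (z ∩ S)) * g (insert i (z \ S))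

variable {ι : Type*} [Fintype ι] [DecidableEq ι]

/-- Averaging first along the `i`-th coordinate. -/
theorem expect_eq_expect_toggle (φ : Finset ι → ℝ) (i : ι) :
    𝔼 z, φ z = 𝔼 z, (φ (z.erase i) + φ (insert i z)) / 2 := by
  let σ : Finset ι ≃ Finset ι := (symmDiff_right_involutive {i}).toPerm _
  have h1 : 𝔼 z, φ z = 𝔼 z, φ (σ z) := (Fintype.expect_equiv σ _ _ fun _ => rfl).symm
  have h2 : ∀ z, (φ (z.erase i) + φ (insert i z)) / 2 = φ z * (1 / 2) + φ (σ z) * (1 / 2) := by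
    intro z
    by_cases hz : i ∈ z
    · have e : σ z = z.erase i := by
        ext j; simp only [σ, Function.Involutive.coe_toPerm, mem_symmDiff, mem_singleton, mem_erase]
        by_cases h : j = i <;> simp_all
      rw [e, insert_eq_of_mem hz]; ring
    · have e : σ z = insert i z := by
        ext j; simp only [σ, Function.Involutive.coe_toPerm, mem_symmDiff, mem_singleton, mem_insert]
        by_cases h : j = i <;> simp_all
      rw [e, erase_eq_of_notMem hz]; ring
  simp_rw [h2]
  rw [expect_add_distrib, ← expect_mul, ← expect_mul, ← h1]
  ring

/-- The moment generating function of a linear form in independent uniform signs. -/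
theorem expect_exp_sum_le (u : ι → ℝ) :
    𝔼 z : Finset ι, Real.exp (∑ i, u i * sign i z) ≤ Real.exp ((∑ i, u i ^ 2) / 2) := by
  have h : 𝔼 z : Finset ι, Real.exp (∑ i, u i * sign i z) = ∏ i, Real.cosh (u i) := by
    have : ∀ z : Finset ι, Real.exp (∑ i, u i * sign i z) =
        (∏ i ∈ z, Real.exp (u i)) * ∏ i ∈ zᶜ, Real.exp (-u i) := by
      intro z
      rw [Real.exp_sum, ← Finset.prod_mul_prod_compl z]
      congr 1
      · exact prod_congr rfl fun i hi => by simp [sign, hi]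
      · exact prod_congr rfl fun i hi => by simp [sign, mem_compl.1 hi]
    simp_rw [this, Fintype.expect_eq_sum_div_card, ← Fintype.prod_add, Real.cosh_eq]
    rw [prod_div_distrib]
    simp
  rw [h, sum_div, Real.exp_sum]
  exact prod_le_prod (fun i _ => (Real.cosh_pos _).le) fun i _ => Real.cosh_le_exp_half_sq _

/-- A level-one inequality: a dense subset of the cube has small coordinate biases. -/
theorem sum_sq_coeff_div_le (h : Finset ι → ℝ) (h0 : ∀ z, 0 ≤ h z) (h1 : ∀ z, h z ≤ 1) (L : ℝ) :
    ∑ i, (𝔼 z, h z * sign i z) ^ 2 / (𝔼 z, h z) ≤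
      2 * ((𝔼 z, h z) * (L - 1) + Real.exp (-L)) := by
  set F := 𝔼 z, h z with hF
  have F0 : 0 ≤ F := expect_nonneg fun z _ => h0 z
  -- For `F = 0` the left side vanishes by the convention `x / 0 = 0`.
  rcases F0.eq_or_lt with hz | hpos
  · simp only [← hz, div_zero, sum_const_zero, zero_mul, zero_add]
    positivity
  set c : ι → ℝ := fun i => 𝔼 z, h z * sign i z with hc
  set u : ι → ℝ := fun i => c i / F with hu
  set Q := ∑ i, u i ^ 2 with hQ
  -- Since `0 ≤ h ≤ 1`, `h * (t + 1) ≤ exp t` for every real `t`; the shift `Q / 2` cancels the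
  -- moment generating function. The choice `L = log (1 / F)` would give the usual `2 F log (1 /
  -- F)`. A free `L` keeps the bound affine in `F`, so that it can be averaged over `S` and summed
  -- over leaves.
  have key : 𝔼 z, h z * (∑ i, u i * sign i z - (Q / 2 + L) + 1) ≤ Real.exp (-L) := by
    calc 𝔼 z, h z * (∑ i, u i * sign i z - (Q / 2 + L) + 1)
        ≤ 𝔼 z, Real.exp (∑ i, u i * sign i z) * Real.exp (-(Q / 2 + L)) := by
          refine expect_le_expect fun z _ => ?_
          rw [← Real.exp_add, ← sub_eq_add_neg]
          have := Real.add_one_le_exp (∑ i, u i * sign i z - (Q / 2 + L))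
          have := Real.exp_pos (∑ i, u i * sign i z - (Q / 2 + L))
          nlinarith [h0 z, h1 z]
      _ ≤ Real.exp (Q / 2) * Real.exp (-(Q / 2 + L)) := by
          rw [← expect_mul]
          exact mul_le_mul_of_nonneg_right (expect_exp_sum_le u) (Real.exp_pos _).le
      _ = Real.exp (-L) := by rw [← Real.exp_add]; ring_nf
  have lhs : 𝔼 z, h z * (∑ i, u i * sign i z - (Q / 2 + L) + 1) =
      F * Q - F * (Q / 2 + L - 1) := by
    have : ∀ z, h z * (∑ i, u i * sign i z - (Q / 2 + L) + 1) =
        ∑ i, u i * (h z * sign i z) - h z * (Q / 2 + L - 1) := by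
      intro z
      rw [show ∑ i, u i * (h z * sign i z) = h z * ∑ i, u i * sign i z by
        rw [mul_sum]; exact sum_congr rfl fun i _ => by ring]
      ring
    simp_rw [this]
    rw [expect_sub_distrib, ← expect_mul, expect_sum_comm, ← hF]
    congr 1
    rw [hQ, mul_sum]
    refine sum_congr rfl fun i _ => ?_
    rw [← mul_expect]
    change u i * c i = _
    simp only [hu]; field_simp
  rw [lhs] at key
  have : ∑ i, c i ^ 2 / F = F * Q := by
    rw [hQ, mul_sum]
    refine sum_congr rfl fun i _ => ?_
    simp only [hu]; field_simp
  change ∑ i, c i ^ 2 / F ≤ _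
  rw [this]
  linarith

/-- `z ∩ S` and `z \ S` are independent for a uniformly random `z`. -/
theorem expect_inter_mul_sdiff (f g : Finset ι → ℝ) (S : Finset ι) :
    𝔼 z, f (z ∩ S) * g (z \ S) = (𝔼 z, f (z ∩ S)) * 𝔼 z, g (z \ S) := by
  -- `τ` exchanges the parts outside `S` of two independent points.
  let τ : Finset ι × Finset ι → Finset ι × Finset ι :=
    fun p => (p.1 ∩ S ∪ p.2 \ S, p.2 ∩ S ∪ p.1 \ S)
  have hτ : Function.Involutive τ := by
    rintro ⟨a, b⟩
    simp only [τ, Prod.mk.injEq]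
    constructor <;> ext j <;> by_cases hj : j ∈ S <;> simp [hj]
  have h1 : (𝔼 z, f (z ∩ S)) * 𝔼 z, g (z \ S) =
      𝔼 p : Finset ι × Finset ι, f (p.1 ∩ S) * g (p.2 \ S) := by
    rw [expect_mul_expect, ← univ_product_univ, expect_product]
  have h2 : 𝔼 z, f (z ∩ S) * g (z \ S) =
      𝔼 p : Finset ι × Finset ι, f (p.1 ∩ S) * g (p.1 \ S) := by
    rw [← univ_product_univ, expect_product]
    simp [expect_const univ_nonempty]
  rw [h1, h2]
  refine Fintype.expect_equiv (hτ.toPerm τ) _ _ ?_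
  rintro ⟨a, b⟩
  have e1 : (τ (a, b)).1 ∩ S = a ∩ S := by ext j; by_cases hj : j ∈ S <;> simp [τ, hj]
  have e2 : (τ (a, b)).2 \ S = a \ S := by ext j; by_cases hj : j ∈ S <;> simp [τ, hj]
  simp only [Function.Involutive.coe_toPerm, e1, e2]

/-- With s = u + v and d = u - v, the right side minus the left is 1/4 + 11s/8 + 9s²/4 - s³ + d²(7 +
4s)/4, which settles s ≥ -7/4. It also equals 1/4 + 11s/8 + 4s² - uv(7 + 4s), which settles s ≤
-7/4, where uv ≥ 0. -/
theorem bias_inequality {u v : ℝ} (hu : |u| ≤ 1) (hv : |v| ≤ 1) :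
    3 / 8 * ((1 - u) + (1 - v)) ≤
      (1 + u) * (1 + v) + 4 * ((1 - v) * u ^ 2 + (1 - u) * v ^ 2) := by
  obtain ⟨u1, u2⟩ := abs_le.1 hu
  obtain ⟨v1, v2⟩ := abs_le.1 hv
  rcases le_total (u + v) (-7 / 4) with h | h
  · have p : 0 ≤ u * v := mul_nonneg_of_nonpos_of_nonpos (by linarith) (by linarith)
    nlinarith [mul_nonneg p (by linarith : 0 ≤ -(7 + 4 * (u + v)))]
  · have p : 0 ≤ (u - v) ^ 2 * (7 + 4 * (u + v)) :=
      mul_nonneg (sq_nonneg _) (by linarith)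
    have q : 0 ≤ 1 / 4 + 11 / 8 * (u + v) + 9 / 4 * (u + v) ^ 2 - (u + v) ^ 3 := by
      have : u + v ≤ 2 := by linarith
      nlinarith [sq_nonneg (u + v + 1 / 3), mul_nonneg (sq_nonneg (u + v))
        (by linarith : 0 ≤ 2 - (u + v)), sq_nonneg (u + v), sq_nonneg (u + v + 1 / 4)]
    nlinarith

/-- The inequality behind the corruption bound, for a `2 × 2` rectangle. -/
theorem two_by_two_inequality {a₀ a₁ b₀ b₁ : ℝ} (ha₀ : 0 ≤ a₀) (ha₁ : 0 ≤ a₁) (hb₀ : 0 ≤ b₀)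
    (hb₁ : 0 ≤ b₁) :
    3 / 4 * (((a₀ * (b₀ + b₁) / 2) + ((a₀ + a₁) / 2 * b₀)) / 2) ≤ a₁ * b₁ +
      8 * ((((a₀ * (b₁ - b₀) / 2) ^ 2 / (a₀ * (b₀ + b₁) / 2)) +
        (((a₁ - a₀) / 2 * b₀) ^ 2 / ((a₀ + a₁) / 2 * b₀))) / 2) := by
  rcases (add_nonneg ha₀ ha₁).eq_or_lt with ha | ha
  · obtain rfl : a₀ = 0 := by linarith
    obtain rfl : a₁ = 0 := by linarith
    simp
  rcases (add_nonneg hb₀ hb₁).eq_or_lt with hb | hb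
  · obtain rfl : b₀ = 0 := by linarith
    obtain rfl : b₁ = 0 := by linarith
    simp
  -- `a` is the mean of `a₀` and `a₁`, and `u` the relative bias. After division by `a * b` only the
  -- biases remain.
  obtain ⟨a, u, hapos, hu, rfl, rfl⟩ : ∃ a u, 0 < a ∧ |u| ≤ 1 ∧ a₀ = a * (1 - u) ∧
      a₁ = a * (1 + u) := by
    refine ⟨(a₀ + a₁) / 2, (a₁ - a₀) / (a₀ + a₁), by positivity, ?_, ?_, ?_⟩
    · rw [abs_div, abs_of_pos ha, div_le_one ha]; exact abs_le.2 ⟨by linarith, by linarith⟩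
    · field_simp; ring
    · field_simp; ring
  obtain ⟨b, v, hbpos, hv, rfl, rfl⟩ : ∃ b v, 0 < b ∧ |v| ≤ 1 ∧ b₀ = b * (1 - v) ∧
      b₁ = b * (1 + v) := by
    refine ⟨(b₀ + b₁) / 2, (b₁ - b₀) / (b₀ + b₁), by positivity, ?_, ?_, ?_⟩
    · rw [abs_div, abs_of_pos hb, div_le_one hb]; exact abs_le.2 ⟨by linarith, by linarith⟩
    · field_simp; ring
    · field_simp; ring
  -- The case `x = 0` does occur, at `u = 1` or `v = 1`, and rests on `x / 0 = 0`.
  have quot : ∀ x y : ℝ, (x * y) ^ 2 / x = x * y ^ 2 := by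
    intro x y
    by_cases hx : x = 0
    · simp [hx]
    · field_simp
  have e1 : (a * (1 - u) * (b * (1 + v) - b * (1 - v)) / 2) ^ 2 /
      (a * (1 - u) * (b * (1 - v) + b * (1 + v)) / 2) = a * b * ((1 - u) * v ^ 2) := by
    rw [show a * (1 - u) * (b * (1 + v) - b * (1 - v)) / 2 = (a * (1 - u) * b) * v by ring,
      show a * (1 - u) * (b * (1 - v) + b * (1 + v)) / 2 = a * (1 - u) * b by ring, quot]
    ring
  have e2 : ((a * (1 + u) - a * (1 - u)) / 2 * (b * (1 - v))) ^ 2 /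
      ((a * (1 - u) + a * (1 + u)) / 2 * (b * (1 - v))) = a * b * ((1 - v) * u ^ 2) := by
    rw [show (a * (1 + u) - a * (1 - u)) / 2 * (b * (1 - v)) = (a * b * (1 - v)) * u by ring,
      show (a * (1 - u) + a * (1 + u)) / 2 * (b * (1 - v)) = a * b * (1 - v) by ring, quot]
    ring
  rw [e1, e2]
  have := mul_le_mul_of_nonneg_left (bias_inequality hu hv) (mul_pos hapos hbpos).le
  linarith

/-- The corruption inequality for a fixed coordinate `i`. -/
theorem corruption_coordinate (f g : Finset ι → ℝ) (hf : ∀ x, 0 ≤ f x) (hg : ∀ y, 0 ≤ g y)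
    (i : ι) :
    3 / 4 * 𝔼 S, splitAvg f g S ≤ 𝔼 S, meetAvg f g S i +
      8 * 𝔼 S, splitCoeff f g S i ^ 2 / splitAvg f g S := by
  -- Splittings are paired as `S.erase i` and `insert i S`: coordinate `i` of `z` is seen by `g`
  -- alone in the first and by `f` alone in the second. By independence everything reduces to the
  -- four averages with `i` forced out or in.
  rw [expect_eq_expect_toggle (fun S => splitAvg f g S) i,
    expect_eq_expect_toggle (fun S => splitCoeff f g S i ^ 2 / splitAvg f g S) i,
    mul_expect, mul_expect, ← expect_add_distrib]
  refine expect_le_expect fun S _ => ?_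
  set a₀ := 𝔼 z : Finset ι, f ((z ∩ S).erase i) with ha₀
  set a₁ := 𝔼 z : Finset ι, f (insert i (z ∩ S)) with ha₁
  set b₀ := 𝔼 z : Finset ι, g ((z \ S).erase i) with hb₀
  set b₁ := 𝔼 z : Finset ι, g (insert i (z \ S)) with hb₁
  have meet : meetAvg f g S i = a₁ * b₁ :=
    expect_inter_mul_sdiff (fun x => f (insert i x)) (fun y => g (insert i y)) S
  have zero_one : 𝔼 z : Finset ι, f ((z ∩ S).erase i) * g (insert i (z \ S)) = a₀ * b₁ :=
    expect_inter_mul_sdiff (fun x => f (x.erase i)) (fun y => g (insert i y)) S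
  have one_zero : 𝔼 z : Finset ι, f (insert i (z ∩ S)) * g ((z \ S).erase i) = a₁ * b₀ :=
    expect_inter_mul_sdiff (fun x => f (insert i x)) (fun y => g (y.erase i)) S
  have zero_zero : 𝔼 z : Finset ι, f ((z ∩ S).erase i) * g ((z \ S).erase i) = a₀ * b₀ :=
    expect_inter_mul_sdiff (fun x => f (x.erase i)) (fun y => g (y.erase i)) S
  have i1 : ∀ z : Finset ι, z.erase i ∩ insert i S = (z ∩ S).erase i := by
    intro z; ext j; by_cases h : j = i <;> simp [h]
  have i2 : ∀ z : Finset ι, insert i z ∩ insert i S = insert i (z ∩ S) := by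
    intro z; ext j; by_cases h : j = i <;> simp [h]
  have i3 : ∀ z : Finset ι, z.erase i \ insert i S = (z \ S).erase i := by
    intro z; ext j; by_cases h : j = i <;> simp [h]
  have i4 : ∀ z : Finset ι, insert i z \ insert i S = (z \ S).erase i := by
    intro z; ext j; by_cases h : j = i <;> simp [h]
  have e1 : ∀ z : Finset ι, z.erase i ∩ S.erase i = (z ∩ S).erase i := by
    intro z; ext j; by_cases h : j = i <;> simp [h]
  have e2 : ∀ z : Finset ι, insert i z ∩ S.erase i = (z ∩ S).erase i := by
    intro z; ext j; by_cases h : j = i <;> simp [h]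
  have e3 : ∀ z : Finset ι, z.erase i \ S.erase i = (z \ S).erase i := by
    intro z; ext j; by_cases h : j = i <;> simp [h]
  have e4 : ∀ z : Finset ι, insert i z \ S.erase i = insert i (z \ S) := by
    intro z; ext j; by_cases h : j = i <;> simp [h]
  have s1 : ∀ z : Finset ι, sign i (z.erase i) = -1 := fun z => by simp [sign]
  have s2 : ∀ z : Finset ι, sign i (insert i z) = 1 := fun z => by simp [sign]
  have D1 : splitAvg f g (insert i S) = (a₀ + a₁) / 2 * b₀ := by
    rw [splitAvg, expect_eq_expect_toggle _ i]
    simp_rw [i1, i2, i3, i4]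
    rw [← expect_div, expect_add_distrib, zero_zero, one_zero]; ring
  have D0 : splitAvg f g (S.erase i) = a₀ * (b₀ + b₁) / 2 := by
    rw [splitAvg, expect_eq_expect_toggle _ i]
    simp_rw [e1, e2, e3, e4]
    rw [← expect_div, expect_add_distrib, zero_zero, zero_one]; ring
  have C1 : splitCoeff f g (insert i S) i = (a₁ - a₀) / 2 * b₀ := by
    rw [splitCoeff, expect_eq_expect_toggle _ i]
    simp_rw [i1, i2, i3, i4, s1, s2]
    rw [← expect_div, expect_add_distrib, ← expect_mul, ← expect_mul, zero_zero, one_zero]; ring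
  have C0 : splitCoeff f g (S.erase i) i = a₀ * (b₁ - b₀) / 2 := by
    rw [splitCoeff, expect_eq_expect_toggle _ i]
    simp_rw [e1, e2, e3, e4, s1, s2]
    rw [← expect_div, expect_add_distrib, ← expect_mul, ← expect_mul, zero_zero, zero_one]; ring
  rw [meet, D0, D1, C0, C1]
  exact two_by_two_inequality (expect_nonneg fun _ _ => hf _) (expect_nonneg fun _ _ => hf _)
    (expect_nonneg fun _ _ => hg _) (expect_nonneg fun _ _ => hg _)

/-- The corruption bound for disjointness: a rectangle that is dense among the disjoint pairs
contains a proportional part of the uniquely intersecting pairs. -/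
theorem corruption (f g : Finset ι → ℝ) (hf : ∀ x, 0 ≤ f x ∧ f x ≤ 1)
    (hg : ∀ y, 0 ≤ g y ∧ g y ≤ 1) (L : ℝ) :
    3 / 4 * Fintype.card ι * 𝔼 S, splitAvg f g S ≤ ∑ i, 𝔼 S, meetAvg f g S i +
      16 * ((𝔼 S, splitAvg f g S) * (L - 1) + Real.exp (-L)) := by
  have h1 : ∑ i : ι, 3 / 4 * 𝔼 S, splitAvg f g S ≤ ∑ i, (𝔼 S, meetAvg f g S i +
      8 * 𝔼 S, splitCoeff f g S i ^ 2 / splitAvg f g S) :=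
    sum_le_sum fun i _ => corruption_coordinate f g (fun x => (hf x).1) (fun y => (hg y).1) i
  have h2 : 𝔼 S, ∑ i, splitCoeff f g S i ^ 2 / splitAvg f g S ≤
      𝔼 S, 2 * (splitAvg f g S * (L - 1) + Real.exp (-L)) :=
    expect_le_expect fun S _ => sum_sq_coeff_div_le (fun z => f (z ∩ S) * g (z \ S))
      (fun z => mul_nonneg (hf _).1 (hg _).1)
      (fun z => mul_le_one₀ (hf _).2 (hg _).1 (hg _).2) L
  rw [← mul_expect, expect_add_distrib, ← expect_mul, expect_const univ_nonempty,
    expect_sum_comm] at h2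
  rw [sum_add_distrib, sum_const, card_univ, nsmul_eq_mul, ← mul_sum] at h1
  linarith

end Cube

/-! ### Randomized communication complexity of unique disjointness -/

namespace Cube

open Finset
open scoped BigOperators

variable {ι : Type*} [Fintype ι] [DecidableEq ι]

/-- The average of `h` over a distribution of pairs of disjoint sets. -/
noncomputable def disjAvg (h : Finset ι → Finset ι → ℝ) : ℝ :=
  𝔼 S : Finset ι, 𝔼 z : Finset ι, h (z ∩ S) (z \ S)

/-- The sum over `i` of the averages of `h` over a distribution of pairs of sets intersecting
exactly in `i`. -/
noncomputable def meetSum (h : Finset ι → Finset ι → ℝ) : ℝ :=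
  ∑ i : ι, 𝔼 S : Finset ι, 𝔼 z : Finset ι, h (insert i (z ∩ S)) (insert i (z \ S))

theorem disjAvg_add (h h' : Finset ι → Finset ι → ℝ) :
    disjAvg (fun x y => h x y + h' x y) = disjAvg h + disjAvg h' := by
  simp_rw [disjAvg, expect_add_distrib]

theorem meetSum_add (h h' : Finset ι → Finset ι → ℝ) :
    meetSum (fun x y => h x y + h' x y) = meetSum h + meetSum h' := by
  simp_rw [meetSum, expect_add_distrib, sum_add_distrib]

/-- The indicator function of the event that a protocol outputs `true`. -/
def accepts {X Y : Type*} (p : Protocol X Y Bool) (x : X) (y : Y) : ℝ :=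
  if p.run x y = true then 1 else 0

/-- The corruption bound, summed over the leaves of a protocol. -/
theorem corruption_protocol {X Y : Type*} (α : Finset ι → X) (β : Finset ι → Y) (L : ℝ)
    (p : Protocol X Y Bool) : ∀ (k : ℕ) (f g : Finset ι → ℝ), (∀ x, 0 ≤ f x ∧ f x ≤ 1) →
    (∀ y, 0 ≤ g y ∧ g y ≤ 1) → (∀ x y, f x ≠ 0 → g y ≠ 0 → p.bits (α x) (β y) ≤ k) →
    3 / 4 * Fintype.card ι * disjAvg (fun x y => f x * g y * accepts p (α x) (β y)) ≤
      meetSum (fun x y => f x * g y * accepts p (α x) (β y)) +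
      16 * (disjAvg (fun x y => f x * g y * accepts p (α x) (β y)) * (L - 1) +
        Real.exp (-L) * 2 ^ k) := by
  -- This covers rejecting leaves, and nodes that send a bit although `k = 0`, where the bit bound
  -- forces the weight to vanish.
  have hzero : ∀ (h : Finset ι → Finset ι → ℝ) (k : ℕ), (∀ x y, h x y = 0) →
      3 / 4 * Fintype.card ι * disjAvg h ≤ meetSum h +
        16 * (disjAvg h * (L - 1) + Real.exp (-L) * 2 ^ k) := by
    intro h k hh
    have h1 : disjAvg h = 0 := by simp [disjAvg, hh]
    have h2 : meetSum h = 0 := by simp [meetSum, hh]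
    rw [h1, h2]
    simp only [mul_zero, zero_mul, zero_add]
    positivity
  have hfac : ∀ (f : Finset ι → ℝ), (∀ x, 0 ≤ f x ∧ f x ≤ 1) → ∀ c : Finset ι → Prop,
      ∀ [DecidablePred c], ∀ x, 0 ≤ (if c x then f x else 0) ∧ (if c x then f x else 0) ≤ 1 := by
    intro f hf c _ x
    split_ifs
    · exact hf x
    · exact ⟨le_rfl, zero_le_one⟩
  induction p with
  | output b =>
    intro k f g hf hg _
    cases b with
    | false => exact hzero _ k fun x y => by simp [accepts, Protocol.run]
    | true =>
      have := corruption f g hf hg L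
      have hk : Real.exp (-L) ≤ Real.exp (-L) * 2 ^ k :=
        le_mul_of_one_le_right (Real.exp_pos _).le (one_le_pow₀ one_le_two)
      simp only [accepts, Protocol.run, if_true, mul_one]
      simp only [disjAvg, meetSum]
      simp only [splitAvg, meetAvg] at this
      linarith
  | alice send next ih =>
    intro k f g hf hg hbits
    cases k with
    | zero =>
      refine hzero _ 0 fun x y => ?_
      by_contra hne
      have := hbits x y (fun h => hne (by simp [h])) fun h => hne (by simp [h])
      simp [Protocol.bits] at this
    | succ k =>
      have ihb : ∀ b, _ := fun b => ih b k (fun x => if send (α x) = b then f x else 0) g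
        (hfac f hf _) hg (fun x y hx hy => by
          have hs : send (α x) = b := by by_contra hs; simp [hs] at hx
          have := hbits x y (fun h => hx (by simp [h])) hy
          simp only [Protocol.bits, hs] at this
          omega)
      -- A message cuts the rectangle in two. Both averages are additive, and the error terms add up
      -- as `2 ^ k + 2 ^ k = 2 ^ (k + 1)`.
      have split : (fun x y => f x * g y * accepts (.alice send next) (α x) (β y)) = fun x y =>
          (if send (α x) = true then f x else 0) * g y * accepts (next true) (α x) (β y) +
          (if send (α x) = false then f x else 0) * g y * accepts (next false) (α x) (β y) := by
        funext x y
        cases h : send (α x) <;> simp [accepts, Protocol.run, h]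
      rw [split, disjAvg_add, meetSum_add, pow_succ]
      linarith [ihb true, ihb false]
  | bob send next ih =>
    intro k f g hf hg hbits
    cases k with
    | zero =>
      refine hzero _ 0 fun x y => ?_
      by_contra hne
      have := hbits x y (fun h => hne (by simp [h])) fun h => hne (by simp [h])
      simp [Protocol.bits] at this
    | succ k =>
      have ihb : ∀ b, _ := fun b => ih b k f (fun y => if send (β y) = b then g y else 0)
        hf (hfac g hg _) (fun x y hx hy => by
          have hs : send (β y) = b := by by_contra hs; simp [hs] at hy
          have := hbits x y hx (fun h => hy (by simp [h]))
          simp only [Protocol.bits, hs] at this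
          omega)
      have split : (fun x y => f x * g y * accepts (.bob send next) (α x) (β y)) = fun x y =>
          f x * (if send (β y) = true then g y else 0) * accepts (next true) (α x) (β y) +
          f x * (if send (β y) = false then g y else 0) * accepts (next false) (α x) (β y) := by
        funext x y
        cases h : send (β y) <;> simp [accepts, Protocol.run, h]
      rw [split, disjAvg_add, meetSum_add, pow_succ]
      linarith [ihb true, ihb false]

/-- A protocol exchanging few bits that accepts most disjoint pairs accepts many uniquely
intersecting pairs. -/
theorem disjAvg_accepts_le {X Y : Type*} (α : Finset ι → X) (β : Finset ι → Y)
    (p : Protocol X Y Bool) (k : ℕ) (hk : ∀ x y, p.bits (α x) (β y) ≤ k) :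
    3 / 4 * Fintype.card ι * disjAvg (fun x y => accepts p (α x) (β y)) ≤
      meetSum (fun x y => accepts p (α x) (β y)) + 16 * (k + 1) := by
  -- With `L = k` the leaves together contribute at most (2/e)^k ≤ 1.
  have h := corruption_protocol α β k p k (fun _ => 1) (fun _ => 1) (by simp) (by simp)
    fun x y _ _ => hk _ _
  simp only [one_mul] at h
  have acc : ∀ x y, 0 ≤ accepts p x y ∧ accepts p x y ≤ 1 := by
    intro x y
    unfold accepts
    split_ifs <;> simp
  have h0 : 0 ≤ disjAvg (fun x y => accepts p (α x) (β y)) :=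
    expect_nonneg fun S _ => expect_nonneg fun z _ => (acc _ _).1
  have h1 : disjAvg (fun x y => accepts p (α x) (β y)) ≤ 1 :=
    expect_le univ_nonempty fun S _ => expect_le univ_nonempty fun z _ => (acc _ _).2
  have he : Real.exp (-(k : ℝ)) * 2 ^ k ≤ 1 := by
    rw [Real.exp_neg, inv_mul_le_one₀ (Real.exp_pos _), ← mul_one (k : ℝ), Real.exp_nat_mul]
    exact pow_le_pow_left₀ (by norm_num) (by linarith [Real.add_one_le_exp 1]) k
  have hk0 : (0 : ℝ) ≤ k := Nat.cast_nonneg k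
  nlinarith

/-! ### Averaging over the random coins -/

theorem integrable_expect {Ω κ : Type*} [MeasurableSpace Ω] {P : Measure Ω} [Fintype κ]
    {F : κ → Ω → ℝ} (hF : ∀ s, Integrable (F s) P) : Integrable (fun ω => 𝔼 s, F s ω) P := by
  simp_rw [Fintype.expect_eq_sum_div_card]
  exact (integrable_finsetSum _ fun s _ => hF s).div_const _

theorem integral_expect {Ω κ : Type*} [MeasurableSpace Ω] {P : Measure Ω} [Fintype κ]
    {F : κ → Ω → ℝ} (hF : ∀ s, Integrable (F s) P) :
    ∫ ω, 𝔼 s, F s ω ∂P = 𝔼 s, ∫ ω, F s ω ∂P := by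
  simp_rw [Fintype.expect_eq_sum_div_card]
  rw [integral_div, integral_finsetSum _ fun s _ => hF s]

/-- The randomized communication complexity of every problem that contains unique disjointness
is linear in the size of the ground set. -/
theorem card_le_of_randDecidableWith {X Y : Type*} (α : Finset ι → X) (β : Finset ι → Y)
    (f : X → Y → Prop) (hdisj : ∀ x y, Disjoint x y → f (α x) (β y))
    (hmeet : ∀ x y i, x ∩ y = {i} → ¬ f (α x) (β y)) {k : ℕ} (h : RandDecidableWith f k) :
    (Fintype.card ι : ℝ) ≤ 96 * (k + 1) := by
  obtain ⟨Ω, _, P, _, p, hbits, hp⟩ := h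
  set a : Finset ι → Finset ι → Ω → ℝ := fun x y ω => accepts p (α x, ω) (β y, ω) with ha
  have hind : ∀ x y, a x y = {ω | p.run (α x, ω) (β y, ω) = true}.indicator 1 := by
    intro x y
    funext ω
    simp [ha, accepts, Set.indicator_apply]
  have hprob : ∀ x y, MeasurableSet {ω | p.run (α x, ω) (β y, ω) = true} ∧
      (f (α x) (β y) → 2 / 3 ≤ P.real {ω | p.run (α x, ω) (β y, ω) = true}) ∧
      (¬ f (α x) (β y) → P.real {ω | p.run (α x, ω) (β y, ω) = true} ≤ 1 / 3) := by
    intro x y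
    obtain ⟨hm, hP⟩ := hp (α x) (β y)
    have hP' : 2 / 3 ≤ P.real {ω | p.run (α x, ω) (β y, ω) = true ↔ f (α x) (β y)} := by
      have := ENNReal.toReal_mono (measure_ne_top P _) hP
      simpa [Measure.real] using this
    by_cases hf : f (α x) (β y)
    · simp only [hf, iff_true] at hm hP'
      exact ⟨hm, fun _ => hP', fun h => absurd hf h⟩
    · have e : {ω | p.run (α x, ω) (β y, ω) = true ↔ f (α x) (β y)} =
          {ω | p.run (α x, ω) (β y, ω) = true}ᶜ := by
        ext ω; simp [hf]
      rw [e] at hm hP'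
      have hm' : MeasurableSet {ω | p.run (α x, ω) (β y, ω) = true} := by simpa using hm.compl
      refine ⟨hm', fun h => absurd h hf, fun _ => ?_⟩
      rw [probReal_compl_eq_one_sub hm'] at hP'
      linarith
  have hint : ∀ x y, Integrable (a x y) P := by
    intro x y
    rw [hind]
    exact (integrable_const (1 : ℝ)).indicator (hprob x y).1
  have hval : ∀ x y, ∫ ω, a x y ω ∂P = P.real {ω | p.run (α x, ω) (β y, ω) = true} := by
    intro x y
    rw [hind, integral_indicator_one (hprob x y).1]
  have hD : 2 / 3 ≤ ∫ ω, disjAvg (fun x y => a x y ω) ∂P := by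
    simp_rw [disjAvg]
    rw [integral_expect fun S => integrable_expect fun z => hint _ _]
    refine le_expect univ_nonempty fun S _ => ?_
    rw [integral_expect fun z => hint _ _]
    refine le_expect univ_nonempty fun z _ => ?_
    rw [hval]
    exact (hprob _ _).2.1 (hdisj _ _ (disjoint_left.2 fun j => by simp +contextual))
  have hM : ∫ ω, meetSum (fun x y => a x y ω) ∂P ≤ Fintype.card ι * (1 / 3) := by
    simp_rw [meetSum]
    rw [integral_finsetSum _ fun i _ => integrable_expect fun S => integrable_expect fun z =>
      hint _ _]
    have : ∑ _i : ι, (1 / 3 : ℝ) = Fintype.card ι * (1 / 3) := by simp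
    rw [← this]
    refine sum_le_sum fun i _ => ?_
    rw [integral_expect fun S => integrable_expect fun z => hint _ _]
    refine expect_le univ_nonempty fun S _ => ?_
    rw [integral_expect fun z => hint _ _]
    refine expect_le univ_nonempty fun z _ => ?_
    rw [hval]
    refine (hprob _ _).2.2 (hmeet _ _ i ?_)
    ext j
    by_cases hj : j = i <;> simp +contextual [hj]
  have hDi : Integrable (fun ω => disjAvg (fun x y => a x y ω)) P :=
    integrable_expect fun S => integrable_expect fun z => hint _ _
  have hMi : Integrable (fun ω => meetSum (fun x y => a x y ω)) P :=
    integrable_finsetSum _ fun i _ => integrable_expect fun S => integrable_expect fun z =>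
      hint _ _
  have hmain : ∫ ω, 3 / 4 * Fintype.card ι * disjAvg (fun x y => a x y ω) ∂P ≤
      ∫ ω, (meetSum (fun x y => a x y ω) + 16 * (k + 1)) ∂P := by
    -- For fixed `ω` the protocol is deterministic, with `ω` absorbed into both encodings.
    refine integral_mono (hDi.const_mul _) (hMi.add (integrable_const _)) fun ω => ?_
    exact disjAvg_accepts_le (fun x => ((α x, ω) : X × Ω)) (fun y => ((β y, ω) : Y × Ω)) p k
      fun x y => hbits _ _ ω
  rw [integral_const_mul, integral_add hMi (integrable_const _), integral_const] at hmain
  simp only [probReal_univ, one_smul] at hmain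
  have : (0 : ℝ) ≤ Fintype.card ι := Nat.cast_nonneg _
  -- 3/4 · 2/3 - 1/3 = 1/6, so a sixth of the cardinality is at most `16 * (k + 1)`.
  nlinarith

end Cube

/-! ### Markets that encode disjointness -/

/-- A full preference list that orders the elements by a score, lower scores first. -/
theorem exists_prefList_of_score {α : Type*} (s : α → ℕ) :
    ∃ L : PrefList α, ∀ a b, s a < s b → L.1 a b := by
  classical
  let r : α → α → Prop := InvImage (Prod.Lex (· < ·) WellOrderingRel) fun a => (s a, a)
  have hr : ∀ a b, r a b ↔ s a < s b ∨ s a = s b ∧ WellOrderingRel a b := fun a b =>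
    Prod.lex_def
  refine ⟨⟨r, { trichotomous := ?_, irrefl := ?_, trans := ?_ }⟩,
    fun a b h => (hr a b).2 (.inl h)⟩
  · intro a b h1 h2
    rw [hr] at h1 h2
    rcases lt_trichotomy (s a) (s b) with h | h | h
    · exact absurd (.inl h) h1
    · rcases trichotomous_of WellOrderingRel a b with h' | h' | h'
      · exact absurd (.inr ⟨h, h'⟩) h1
      · exact h'
      · exact absurd (.inr ⟨h.symm, h'⟩) h2
    · exact absurd (.inl h) h2
  · intro a h
    rcases (hr a a).1 h with h | h
    · exact lt_irrefl _ h
    · exact irrefl_of WellOrderingRel a h.2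
  · intro a b c h1 h2
    rw [hr] at *
    rcases h1 with h1 | ⟨h1, h1'⟩ <;> rcases h2 with h2 | ⟨h2, h2'⟩
    · exact .inl (h1.trans h2)
    · exact .inl (h2 ▸ h1)
    · exact .inl (h1 ▸ h2)
    · exact .inr ⟨h1.trans h2, trans_of WellOrderingRel h1' h2'⟩

/-- The preference list given by a score, with ties broken arbitrarily. -/
noncomputable def PrefList.ofScore {α : Type*} (s : α → ℕ) : PrefList α :=
  (exists_prefList_of_score s).choose

theorem PrefList.ofScore_of_lt {α : Type*} {s : α → ℕ} {a b : α} (h : s a < s b) :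
    (PrefList.ofScore s).1 a b :=
  (exists_prefList_of_score s).choose_spec a b h

theorem PrefList.score_le {α : Type*} {s : α → ℕ} {a b : α} (h : (PrefList.ofScore s).1 a b) :
    s a ≤ s b := by
  by_contra hlt
  have := (PrefList.ofScore s).2
  exact irrefl_of (PrefList.ofScore s).1 a
    (trans_of (PrefList.ofScore s).1 h (PrefList.ofScore_of_lt (not_le.1 hlt)))

theorem PrefList.irrefl {α : Type*} (L : PrefList α) (a : α) : ¬ L.1 a a := by
  have := L.2
  exact irrefl_of L.1 a

/-! ### The market of two sets of pairs -/

namespace DisjMarket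

open Finset

/-- The names of the participants: `none` is the fixed participant. -/
abbrev Name (ι κ : Type*) := Option (ι ⊕ κ)

variable {ι κ : Type*} [DecidableEq ι] [DecidableEq κ]

/-- The score that a woman gives to a man. -/
def scoreW (x : Finset (ι × κ)) : Name ι κ → Name ι κ → ℕ
  | none, some (.inl _) => 0
  | none, none => 1
  | none, some (.inr _) => 2
  | some (.inl i), some (.inr j) => if (i, j) ∈ x then 0 else 2
  | some (.inl i), some (.inl i') => if i' = i then 1 else 2
  | some (.inl _), none => 2
  | some (.inr j), some (.inr j') => if j' = j then 0 else 2
  | some (.inr _), none => 1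
  | some (.inr _), some (.inl _) => 2

/-- The score that a man gives to a woman. -/
def scoreM (y : Finset (ι × κ)) : Name ι κ → Name ι κ → ℕ
  | none, none => 0
  | none, some (.inr _) => 1
  | none, some (.inl _) => 2
  | some (.inr j), some (.inl i) => if (i, j) ∈ y then 0 else 2
  | some (.inr j), some (.inr j') => if j' = j then 1 else 2
  | some (.inr _), none => 2
  | some (.inl i), some (.inl i') => if i' = i then 0 else 2
  | some (.inl _), none => 1
  | some (.inl _), some (.inr _) => 2

/-- A marriage of names such that every other pair has one side that gives a worse score to the
other one than to their own spouse. -/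
def ScoreStable (x y : Finset (ι × κ)) (ν : Name ι κ ≃ Name ι κ) : Prop :=
  ∀ a b, ν a = b ∨ scoreW x a (ν a) < scoreW x a b ∨ scoreM y b (ν.symm b) < scoreM y b a

/-- A marriage of names such that no pair strictly improves the scores of both sides. -/
def ScoreWeaklyStable (x y : Finset (ι × κ)) (ν : Name ι κ ≃ Name ι κ) : Prop :=
  ∀ a b, scoreW x a b < scoreW x a (ν a) → ¬ scoreM y b a < scoreM y b (ν.symm b)

/-! ### Stable marriages of names -/

theorem scoreStable_refl {x y : Finset (ι × κ)} (h : Disjoint x y) :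
    ScoreStable x y (Equiv.refl _) := by
  rintro (_ | i | j) (_ | i' | j')
  all_goals simp only [Equiv.refl_apply, Equiv.refl_symm, scoreW, scoreM]
  all_goals try simp
  · by_cases hi : i = i' <;> simp [hi]
  · by_cases hx : (i, j') ∈ x
    · have := disjoint_left.1 h hx
      simp [this]
    · simp [hx]
  · by_cases hj : j = j'
    · simp [hj]
    · have : j' ≠ j := fun h => hj h.symm
      simp [this]

/-- Man `inl i` puts woman `inl i` alone in first place, so she can only leave him for some `inr j`
with `(i, j) ∈ x`. Symmetrically, man `inr j` can only leave woman `inr j` for some `inl i` with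
`(i, j) ∈ y`. Disjointness excludes both, so all namesakes are married and `none` is left for
`none`. -/
theorem eq_none_of_scoreWeaklyStable {x y : Finset (ι × κ)} (h : Disjoint x y)
    {ν : Name ι κ ≃ Name ι κ} (hν : ScoreWeaklyStable x y ν) : ν none = none := by
  have inl : ∀ i, ν (some (.inl i)) = some (.inl i) ∨
      ∃ j, ν (some (.inl i)) = some (.inr j) ∧ (i, j) ∈ x := by
    intro i
    by_contra! hcon
    refine hν (some (.inl i)) (some (.inl i)) ?_ ?_
    · rcases e : ν (some (.inl i)) with _ | i' | j
      · simp [scoreW]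
      · have : i' ≠ i := by rintro rfl; exact hcon.1 e
        simp [scoreW, this]
      · simp [scoreW, hcon.2 j e]
    · rcases e : ν.symm (some (.inl i)) with _ | i' | j
      · simp [scoreM]
      · have : i' ≠ i := by
          rintro rfl
          exact hcon.1 (ν.symm_apply_eq.1 e).symm
        simp [scoreM, this]
      · simp [scoreM]
  have inr : ∀ j, ν.symm (some (.inr j)) = some (.inr j) ∨
      ∃ i, ν.symm (some (.inr j)) = some (.inl i) ∧ (i, j) ∈ y := by
    intro j
    by_contra! hcon
    refine hν (some (.inr j)) (some (.inr j)) ?_ ?_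
    · rcases e : ν (some (.inr j)) with _ | i | j'
      · simp [scoreW]
      · simp [scoreW]
      · have : j' ≠ j := by
          rintro rfl
          exact hcon.1 (ν.symm_apply_eq.2 e.symm)
        simp [scoreW, this]
    · rcases e : ν.symm (some (.inr j)) with _ | i | j'
      · simp [scoreM]
      · simp [scoreM, hcon.2 i e]
      · have : j' ≠ j := by rintro rfl; exact hcon.1 e
        simp [scoreM, this]
  have inl' : ∀ i, ν (some (.inl i)) = some (.inl i) := by
    intro i
    rcases inl i with h1 | ⟨j, h1, hx⟩
    · exact h1
    · have h2 : ν.symm (some (.inr j)) = some (.inl i) := ν.symm_apply_eq.2 h1.symm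
      rcases inr j with h3 | ⟨i', h3, hy⟩
      · simp [h2] at h3
      · obtain rfl : i = i' := by simpa [h2] using h3
        exact absurd hy (disjoint_left.1 h hx)
  have inr' : ∀ j, ν (some (.inr j)) = some (.inr j) := by
    intro j
    rcases inr j with h1 | ⟨i, h1, -⟩
    · exact (ν.symm_apply_eq.1 h1).symm
    · have := (ν.symm_apply_eq.1 h1).symm
      simp [inl' i] at this
  rcases e : ν none with _ | i | j
  · rfl
  · simpa using ν.injective (e.trans (inl' i).symm)
  · simpa using ν.injective (e.trans (inr' j).symm)

/-- If `none` were married to `none`, woman `none` would prefer every man `inl i`, who must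
therefore have his first choice, woman `inl i`. Then no man `inr j` has a wife in `inl`, and any
common point of `x` and `y` is a blocking pair. -/
theorem ne_none_of_scoreWeaklyStable {x y : Finset (ι × κ)} {i : ι} {j : κ} (hx : (i, j) ∈ x)
    (hy : (i, j) ∈ y) {ν : Name ι κ ≃ Name ι κ} (hν : ScoreWeaklyStable x y ν) :
    ν none ≠ none := by
  intro hnone
  have inl : ∀ i, ν.symm (some (.inl i)) = some (.inl i) := by
    intro i
    by_contra hcon
    refine hν none (some (.inl i)) ?_ ?_
    · simp [hnone, scoreW]
    · rcases e : ν.symm (some (.inl i)) with _ | i' | j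
      · have := (ν.symm_apply_eq.1 e).symm
        simp [hnone] at this
      · have : i' ≠ i := by rintro rfl; exact hcon e
        simp [scoreM, this]
      · simp [scoreM]
  have inl' : ∀ i, ν (some (.inl i)) = some (.inl i) := fun i => (ν.symm_apply_eq.1 (inl i)).symm
  refine hν (some (.inl i)) (some (.inr j)) (by simp [inl', scoreW, hx]) ?_
  rcases e : ν.symm (some (.inr j)) with _ | i' | j'
  · simp [scoreM, hy]
  · have := (ν.symm_apply_eq.1 e).symm
    simp [inl'] at this
  · by_cases h : j' = j <;> simp [scoreM, hy, h]

/-- The marriage for a pair of sets that intersect exactly in `(i, j)`. -/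
def cycle (i : ι) (j : κ) : Name ι κ ≃ Name ι κ :=
  (Equiv.swap none (some (.inr j))).trans (Equiv.swap (some (.inl i)) (some (.inr j)))

/-- An explicit marriage shows that the "every" problem is not vacuously true here, without appeal
to the Gale–Shapley theorem. Uniqueness of the common point keeps all other pairs from blocking. -/
theorem scoreStable_cycle {x y : Finset (ι × κ)} {i : ι} {j : κ} (h : x ∩ y = {(i, j)}) :
    ScoreStable x y (cycle i j) ∧ cycle i j none ≠ none := by
  have hxy : ∀ i' j', (i', j') ∈ x → (i', j') ∈ y → i' = i ∧ j' = j := fun i' j' h1 h2 => by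
    simpa [h] using mem_inter.2 ⟨h1, h2⟩
  obtain ⟨hx, hy⟩ : (i, j) ∈ x ∧ (i, j) ∈ y := mem_inter.1 (by simp [h])
  have c1 : cycle i j none = some (.inl i) := by simp [cycle]
  have c2 : cycle i j (some (.inl i)) = some (.inr j) := by
    simp [cycle, Equiv.swap_apply_of_ne_of_ne]
  have c3 : cycle i j (some (.inr j)) = none := by
    simp [cycle, Equiv.swap_apply_of_ne_of_ne]
  have c4 : ∀ i', i' ≠ i → cycle i j (some (.inl i')) = some (.inl i') := fun i' hi => by
    simp [cycle, Equiv.swap_apply_of_ne_of_ne, hi]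
  have c5 : ∀ j', j' ≠ j → cycle i j (some (.inr j')) = some (.inr j') := fun j' hj => by
    simp [cycle, Equiv.swap_apply_of_ne_of_ne, hj]
  have d1 := (Equiv.symm_apply_eq _).2 c1.symm
  have d2 := (Equiv.symm_apply_eq _).2 c2.symm
  have d3 := (Equiv.symm_apply_eq _).2 c3.symm
  have d4 := fun i' hi => (Equiv.symm_apply_eq _).2 (c4 i' hi).symm
  have d5 := fun j' hj => (Equiv.symm_apply_eq _).2 (c5 j' hj).symm
  refine ⟨?_, by simp [c1]⟩
  rintro (_ | i' | j') (_ | i'' | j'')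
  · grind [scoreW, scoreM]
  · by_cases i'' = i <;> grind [scoreW, scoreM]
  · by_cases j'' = j <;> grind [scoreW, scoreM]
  · by_cases i' = i <;> grind [scoreW, scoreM]
  · by_cases i' = i <;> by_cases i'' = i <;> grind [scoreW, scoreM]
  · by_cases i' = i <;> by_cases j'' = j <;> grind [scoreW, scoreM]
  · by_cases j' = j <;> grind [scoreW, scoreM]
  · by_cases j' = j <;> by_cases i'' = i <;> grind [scoreW, scoreM]
  · by_cases j' = j <;> by_cases j'' = j <;> grind [scoreW, scoreM]

/-- Alice's input that encodes the set `x`. -/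
noncomputable def profileW {W M : Type*} (e : W ≃ Name ι κ) (e' : M ≃ Name ι κ)
    (x : Finset (ι × κ)) : Profile W M :=
  fun a => PrefList.ofScore fun b => scoreW x (e a) (e' b)

/-- Bob's input that encodes the set `y`. -/
noncomputable def profileM {W M : Type*} (e : W ≃ Name ι κ) (e' : M ≃ Name ι κ)
    (y : Finset (ι × κ)) : Profile M W :=
  fun b => PrefList.ofScore fun a => scoreM y (e' b) (e a)

/-! ### From marriages of names to marriages of `W` and `M` -/

section Transport

variable {W M : Type*} {e : W ≃ Name ι κ} {e' : M ≃ Name ι κ} {x y : Finset (ι × κ)}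

/-- The lists break ties between scores arbitrarily. A strictly worse score rules out a preference
under any tie-breaking, and a strictly better one guarantees it; hence a strong notion implies
stability here and a weak one follows from it below. -/
theorem isStable_of_scoreStable {ν : Name ι κ ≃ Name ι κ} (h : ScoreStable x y ν) :
    IsStable (profileW e e' x) (profileM e e' y) (e.trans (ν.trans e'.symm)) := by
  rintro a b ⟨h1, h2⟩
  rcases h (e a) (e' b) with h3 | h3 | h3
  · refine PrefList.irrefl (profileW e e' x a) b ?_
    simpa [Profile.Prefers, h3] using h1
  · have := PrefList.score_le h1
    simp only [Equiv.trans_apply, Equiv.apply_symm_apply] at this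
    omega
  · have := PrefList.score_le h2
    simp only [Equiv.symm_trans_apply, Equiv.symm_symm, Equiv.apply_symm_apply] at this
    omega

theorem scoreWeaklyStable_of_isStable {μ : W ≃ M}
    (h : IsStable (profileW e e' x) (profileM e e' y) μ) :
    ScoreWeaklyStable x y (e.symm.trans (μ.trans e')) := by
  intro a b h1 h2
  refine h (e.symm a) (e'.symm b) ⟨PrefList.ofScore_of_lt ?_, PrefList.ofScore_of_lt ?_⟩
  · simpa using h1
  · simpa using h2

variable {w : W} {m : M}

theorem inEveryStable_of_disjoint (hw : e w = none) (hm : e' m = none) (h : Disjoint x y) :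
    InEveryStable w m (profileW e e' x) (profileM e e' y) := by
  intro μ hμ
  have := eq_none_of_scoreWeaklyStable h (scoreWeaklyStable_of_isStable hμ)
  simp only [Equiv.trans_apply, ← hw, Equiv.symm_apply_apply] at this
  exact e'.injective (by rw [this, hw, hm])

theorem inSomeStable_of_disjoint (hw : e w = none) (hm : e' m = none) (h : Disjoint x y) :
    InSomeStable w m (profileW e e' x) (profileM e e' y) :=
  ⟨_, isStable_of_scoreStable (scoreStable_refl h),
    inEveryStable_of_disjoint hw hm h _ (isStable_of_scoreStable (scoreStable_refl h))⟩

theorem not_inSomeStable (hw : e w = none) (hm : e' m = none) {i : ι × κ} (h : x ∩ y = {i}) :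
    ¬ InSomeStable w m (profileW e e' x) (profileM e e' y) := by
  rintro ⟨μ, hμ, hwm⟩
  obtain ⟨hx, hy⟩ : i ∈ x ∧ i ∈ y := mem_inter.1 (by simp [h])
  refine ne_none_of_scoreWeaklyStable hx hy (scoreWeaklyStable_of_isStable hμ) ?_
  simp only [Equiv.trans_apply, ← hw, Equiv.symm_apply_apply]
  rw [hwm, hm, hw]

theorem not_inEveryStable (hw : e w = none) (hm : e' m = none) {i : ι × κ} (h : x ∩ y = {i}) :
    ¬ InEveryStable w m (profileW e e' x) (profileM e e' y) := fun hall =>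
  not_inSomeStable hw hm h
    ⟨_, isStable_of_scoreStable (scoreStable_cycle h).1,
      hall _ (isStable_of_scoreStable (scoreStable_cycle h).1)⟩

end Transport

theorem exists_equiv_name {α ι κ : Type*} [Fintype α] [Fintype ι] [Fintype κ]
    (h : Fintype.card α = Fintype.card ι + Fintype.card κ + 1) (a : α) :
    ∃ e : α ≃ Name ι κ, e a = none := by
  classical
  obtain ⟨e⟩ : Nonempty (α ≃ Name ι κ) := Fintype.card_eq.1 (by simp [h])
  exact ⟨e.trans (Equiv.swap (e a) none), by simp⟩

/-- A problem that distinguishes the markets of disjoint sets from those of uniquely intersecting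
sets has quadratic randomized communication complexity. -/
theorem randCC_ge {W M : Type} [Fintype W] [Fintype M] {n : ℕ} (hn : 100 ≤ n)
    (hW : Fintype.card W = n) (hM : Fintype.card M = n) (w : W) (m : M)
    (f : Profile W M → Profile M W → Prop)
    (hf : ∀ PW PM, (InSomeStable w m PW PM ∧ InEveryStable w m PW PM → f PW PM) ∧
      (¬ InSomeStable w m PW PM ∧ ¬ InEveryStable w m PW PM → ¬ f PW PM)) :
    1 / 1000 * (n : ℝ) ^ 2 ≤ (randCC f : ℝ) := by
  -- The infimum is attained because the set is nonempty; for an empty set it would be the default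
  -- 0.
  have hk : RandDecidableWith f (randCC f) := Nat.sInf_mem (exists_randDecidableWith f)
  -- An almost even split of the other n - 1 names makes the ground set, of size `a * b`, as large
  -- as possible.
  set a := (n - 1) / 2 with ha
  set b := n - 1 - (n - 1) / 2 with hb
  obtain ⟨e, he⟩ := exists_equiv_name (ι := Fin a) (κ := Fin b) (by simp; omega) w
  obtain ⟨e', he'⟩ := exists_equiv_name (ι := Fin a) (κ := Fin b) (by simp; omega) m
  have h := Cube.card_le_of_randDecidableWith (profileW e e') (profileM e e') f
    (fun x y hxy => (hf _ _).1 ⟨inSomeStable_of_disjoint he he' hxy,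
      inEveryStable_of_disjoint he he' hxy⟩)
    (fun x y i hxy => (hf _ _).2 ⟨not_inSomeStable he he' hxy, not_inEveryStable he he' hxy⟩) hk
  simp only [Fintype.card_prod, Fintype.card_fin, Nat.cast_mul] at h
  have h1 : (n : ℝ) ≤ 2 * a + 2 := by exact_mod_cast (by omega : n ≤ 2 * a + 2)
  have h2 : (n : ℝ) ≤ 2 * b + 2 := by exact_mod_cast (by omega : n ≤ 2 * b + 2)
  have h3 : (100 : ℝ) ≤ n := by exact_mod_cast hn
  have h4 : ((n : ℝ) - 2) * (n - 2) ≤ 2 * a * (2 * b) :=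
    mul_le_mul (by linarith) (by linarith) (by linarith) (by positivity)
  -- (n - 2)²/4 ≤ 96 (k + 1) with k = `randCC f`, and (n - 2)²/384 - 1 ≥ n²/1000 once n ≥ 100.
  nlinarith

end DisjMarket

theorem theorem6 :
    (∃ c : ℝ, 0 < c ∧ ∃ N : ℕ, ∀ n : ℕ, N ≤ n →
      ∀ (W M : Type) [Fintype W] [Fintype M], Fintype.card W = n → Fintype.card M = n →
        ∀ (w : W) (m : M),
          c * (n : ℝ) ^ 2 ≤
            (randCC (fun (PW : Profile W M) (PM : Profile M W) => InSomeStable w m PW PM) : ℝ)) ∧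
    (∃ c : ℝ, 0 < c ∧ ∃ N : ℕ, ∀ n : ℕ, N ≤ n →
      ∀ (W M : Type) [Fintype W] [Fintype M], Fintype.card W = n → Fintype.card M = n →
        ∀ (w : W) (m : M),
          c * (n : ℝ) ^ 2 ≤
            (randCC (fun (PW : Profile W M) (PM : Profile M W) => InEveryStable w m PW PM) : ℝ)) := by
  refine ⟨⟨1 / 1000, by norm_num, 100, ?_⟩, ⟨1 / 1000, by norm_num, 100, ?_⟩⟩
  · intro n hn W M _ _ hW hM w m
    exact DisjMarket.randCC_ge hn hW hM w m _ fun PW PM => ⟨fun h => h.1, fun h => h.1⟩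
  · intro n hn W M _ _ hW hM w m
    exact DisjMarket.randCC_ge hn hW hM w m _ fun PW PM => ⟨fun h => h.2, fun h => h.2⟩
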